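/- Define $e_0(z) = z$ and $e_{j+1}(z) = e^{e_j(z)}$ for $z \in \mathbb{C}$ and integers $j \ge 0$. Let $k \ge 0$ be an integer, let $p(x, y_1, \ldots, y_k) \in \mathbb{C}[x, y_1, \ldots, y_k]$ be an irreducible polynomial, and let $$f(z) = p\bigl(z, e_1(z), e_2(z), \ldots, e_k(z)\bigr) = p\bigl(z, e^z, e^{e^z}, \ldots, e_k(z)\bigr).$$ Then $f$ has infinitely many zeros in $\mathbb{C}$, unless $p(x, y_1, \ldots, y_k) = g(x) \cdot y_1^{n_1} \cdots y_k^{n_k}$ for some $g(x) \in \mathbb{C}[x]$ and some integers $n_1, \ldots, n_k \ge 0$. -/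

import Mathlib

open Filter Asymptotics Bornology Topology

/-! Expand the polynomial in powers of the outermost exponential `e_k(z)`. If only one power occurs,
it splits off as a factor, and the remaining polynomial involves one exponential fewer. Otherwise
put `w = e_{k-1}(z)`: for large `w` and `z` an iterated logarithm of `w`, the function becomes `∑
a_j(w) e^{jw}`, each `a_j` a nonzero polynomial in `w, log w, log log w, …`.

Such `a_j` vary so slowly that near `2πin` they are almost constant. A real shift `σ_n`, read off a
Newton polygon, makes two terms equal in size and dominant; after rescaling, the sum converges to
`Q(e^u)` with `Q` not a monomial. This limit has an isolated zero, and a Hurwitz argument carries it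
back to zeros `w` of arbitrarily large modulus (`exists_zero_exp_sum`). -/

/-! ### Nearby points at infinity and the logarithm -/

/-- Pairs of complex numbers tending to infinity with quotient tending to one. -/
noncomputable def nearPairs : Filter (ℂ × ℂ) :=
  comap Prod.fst (cobounded ℂ) ⊓ comap (fun x => x.2 / x.1) (𝓝 1)

/-- Functions that near infinity are bounded away from zero, polynomially bounded and slowly
varying. -/
structure ModerateGrowth (a : ℂ → ℂ) : Prop where
  lower : ∃ δ > 0, ∀ᶠ w in cobounded ℂ, δ ≤ ‖a w‖
  upper : ∃ N : ℕ, a =O[cobounded ℂ] (fun w => w ^ N)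
  slow : Tendsto (fun x : ℂ × ℂ => a x.2 / a x.1) nearPairs (𝓝 1)

theorem tendsto_fst_nearPairs : Tendsto Prod.fst nearPairs (cobounded ℂ) :=
  tendsto_comap.mono_left inf_le_left

theorem tendsto_div_nearPairs : Tendsto (fun x : ℂ × ℂ => x.2 / x.1) nearPairs (𝓝 1) :=
  tendsto_comap.mono_left inf_le_right

theorem tendsto_nearPairs {ι : Type*} {l : Filter ι} {u v : ι → ℂ}
    (hu : Tendsto u l (cobounded ℂ)) (h : Tendsto (fun i => v i / u i) l (𝓝 1)) :
    Tendsto (fun i => (u i, v i)) l nearPairs :=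
  tendsto_inf.2 ⟨tendsto_comap_iff.2 hu, tendsto_comap_iff.2 h⟩

theorem tendsto_snd_nearPairs : Tendsto Prod.snd nearPairs (cobounded ℂ) := by
  rw [← tendsto_norm_atTop_iff_cobounded]
  have h1 := tendsto_norm_atTop_iff_cobounded.2 tendsto_fst_nearPairs
  have h2 := tendsto_div_nearPairs.norm
  rw [norm_one] at h2
  refine (h2.pos_mul_atTop one_pos h1).congr' ?_
  filter_upwards [h1.eventually_gt_atTop 0] with x hx
  rw [norm_div, div_mul_cancel₀ _ hx.ne']

theorem Complex.log_norm_le_norm_log (z : ℂ) : Real.log ‖z‖ ≤ ‖Complex.log z‖ := by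
  rw [← Complex.log_re]
  exact Complex.re_le_norm _

theorem Complex.tendsto_log_cobounded : Tendsto Complex.log (cobounded ℂ) (cobounded ℂ) := by
  rw [← tendsto_norm_atTop_iff_cobounded]
  exact tendsto_atTop_mono Complex.log_norm_le_norm_log
    (Real.tendsto_log_atTop.comp tendsto_norm_cobounded_atTop)

theorem Complex.isLittleO_pow_log_id (N : ℕ) :
    (fun w => Complex.log w ^ N) =o[cobounded ℂ] (fun w => w) := by
  have h1 : (fun w => Complex.log w) =O[cobounded ℂ] (fun w => Real.log ‖w‖) := by
    refine IsBigO.of_bound (1 + Real.pi) ?_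
    have := (Real.tendsto_log_atTop.comp
      (tendsto_norm_cobounded_atTop (E := ℂ))).eventually_ge_atTop 1
    filter_upwards [this] with w hw
    simp only [Function.comp] at hw
    have h3 := Complex.norm_le_abs_re_add_abs_im (Complex.log w)
    rw [Complex.log_re, Complex.log_im] at h3
    have h4 := Complex.abs_arg_le_pi w
    rw [Real.norm_eq_abs, abs_of_nonneg (by linarith : 0 ≤ Real.log ‖w‖)]
    rw [abs_of_nonneg (by linarith : 0 ≤ Real.log ‖w‖)] at h3
    nlinarith [Real.pi_pos]
  have h2 : (fun w : ℂ => Real.log ‖w‖ ^ N) =o[cobounded ℂ] (fun w => ‖w‖) :=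
    (Real.isLittleO_pow_log_id_atTop (n := N)).comp_tendsto tendsto_norm_cobounded_atTop
  exact ((h1.pow N).trans_isLittleO h2).of_norm_right

/-- The two logarithms differ by a bounded amount (at most `2π` in imaginary part, even across the
branch cut), while each tends to infinity. -/
theorem tendsto_log_nearPairs :
    Tendsto (fun x : ℂ × ℂ => (Complex.log x.1, Complex.log x.2)) nearPairs nearPairs := by
  have hlog := Complex.tendsto_log_cobounded.comp tendsto_fst_nearPairs
  refine tendsto_nearPairs hlog ?_
  have hn1 := tendsto_norm_atTop_iff_cobounded.2 tendsto_fst_nearPairs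
  have hn2 := tendsto_norm_atTop_iff_cobounded.2 tendsto_snd_nearPairs
  have h2 := tendsto_div_nearPairs.norm
  rw [norm_one] at h2
  have h3 := (Real.continuousAt_log one_ne_zero).tendsto.comp h2
  rw [Real.log_one] at h3
  have hb : IsBoundedUnder (· ≤ ·) nearPairs
      (norm ∘ fun x : ℂ × ℂ => Complex.log x.2 - Complex.log x.1) := by
    refine ⟨1 + 2 * Real.pi, ?_⟩
    rw [eventually_map]
    have h4 := (h3.abs).eventually_lt_const (u := 1) (by simp)
    filter_upwards [h4, hn1.eventually_gt_atTop 0, hn2.eventually_gt_atTop 0] with x hx h1 h2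
    simp only [Function.comp, norm_div] at hx ⊢
    rw [Real.log_div h2.ne' h1.ne'] at hx
    refine (Complex.norm_le_abs_re_add_abs_im _).trans ?_
    rw [Complex.sub_re, Complex.sub_im, Complex.log_re, Complex.log_re, Complex.log_im,
      Complex.log_im]
    have := abs_sub (Complex.arg x.2) (Complex.arg x.1)
    linarith [Complex.abs_arg_le_pi x.1, Complex.abs_arg_le_pi x.2]
  have h5 := (tendsto_inv₀_cobounded.comp hlog).zero_mul_isBoundedUnder_le hb
  have h6 := h5.const_add 1
  rw [add_zero] at h6
  refine h6.congr' ?_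
  filter_upwards [hlog.eventually_ne_cobounded 0] with x hx
  simp only [Function.comp] at hx ⊢
  field_simp
  ring

/-! ### Functions of moderate growth -/

namespace ModerateGrowth

variable {a b : ℂ → ℂ}

theorem eventually_ne_zero (ha : ModerateGrowth a) : ∀ᶠ w in cobounded ℂ, a w ≠ 0 := by
  obtain ⟨δ, hδ, h⟩ := ha.lower
  filter_upwards [h] with w hw
  exact norm_pos_iff.1 (hδ.trans_le hw)

theorem one_isBigO (ha : ModerateGrowth a) : (fun _ => (1 : ℂ)) =O[cobounded ℂ] a := by
  obtain ⟨δ, hδ, h⟩ := ha.lower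
  refine IsBigO.of_bound δ⁻¹ ?_
  filter_upwards [h] with w hw
  rw [norm_one, inv_mul_eq_div, le_div_iff₀ hδ, one_mul]
  exact hw

theorem const {c : ℂ} (hc : c ≠ 0) : ModerateGrowth (fun _ => c) where
  lower := ⟨‖c‖, norm_pos_iff.2 hc, by simp⟩
  upper := ⟨0, by simpa using isBigO_const_const c (one_ne_zero (α := ℂ)) _⟩
  slow := by simpa [div_self hc] using tendsto_const_nhds

theorem comp_log (ha : ModerateGrowth a) : ModerateGrowth (fun w => a (Complex.log w)) where
  lower := by
    obtain ⟨δ, hδ, h⟩ := ha.lower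
    exact ⟨δ, hδ, Complex.tendsto_log_cobounded.eventually h⟩
  upper := by
    obtain ⟨N, hN⟩ := ha.upper
    refine ⟨1, ?_⟩
    simp only [pow_one]
    exact (hN.comp_tendsto Complex.tendsto_log_cobounded).trans
      (Complex.isLittleO_pow_log_id N).isBigO
  slow := ha.slow.comp tendsto_log_nearPairs

theorem comp_log_isLittleO (ha : ModerateGrowth a) :
    (fun w => a (Complex.log w)) =o[cobounded ℂ] (fun w => w) := by
  obtain ⟨N, hN⟩ := ha.upper
  exact (hN.comp_tendsto Complex.tendsto_log_cobounded).trans_isLittleO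
    (Complex.isLittleO_pow_log_id N)

theorem mul_pow (ha : ModerateGrowth a) (d : ℕ) : ModerateGrowth (fun w => a w * w ^ d) where
  lower := by
    obtain ⟨δ, hδ, h⟩ := ha.lower
    refine ⟨δ, hδ, ?_⟩
    filter_upwards [h, tendsto_norm_cobounded_atTop.eventually_ge_atTop 1] with w hw h1
    rw [norm_mul, norm_pow]
    nlinarith [one_le_pow₀ h1 (n := d)]
  upper := by
    obtain ⟨N, hN⟩ := ha.upper
    refine ⟨N + d, ?_⟩
    simp only [pow_add]
    exact hN.mul (isBigO_refl _ _)
  slow := by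
    have := ha.slow.mul (tendsto_div_nearPairs.pow d)
    rw [one_pow, mul_one] at this
    refine this.congr fun x => ?_
    rw [div_pow, div_mul_div_comm]

theorem congr_equivalent (ha : ModerateGrowth a) (h : b ~[cobounded ℂ] a) :
    ModerateGrowth b where
  lower := by
    obtain ⟨c, hc, h1⟩ := (ha.one_isBigO.trans h.isBigO_symm).exists_pos
    refine ⟨c⁻¹, inv_pos.2 hc, ?_⟩
    filter_upwards [h1.bound] with w hw
    rw [norm_one] at hw
    rw [inv_le_iff_one_le_mul₀' hc]
    exact hw
  upper := by
    obtain ⟨N, hN⟩ := ha.upper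
    exact ⟨N, h.isBigO.trans hN⟩
  slow := by
    have hq : Tendsto (fun w => b w / a w) (cobounded ℂ) (𝓝 1) :=
      (isEquivalent_iff_tendsto_one ha.eventually_ne_zero).1 h
    have h1 := ((hq.comp tendsto_snd_nearPairs).mul ha.slow).div
      (hq.comp tendsto_fst_nearPairs) one_ne_zero
    rw [one_mul, div_one] at h1
    refine h1.congr' ?_
    filter_upwards [tendsto_fst_nearPairs.eventually ha.eventually_ne_zero,
      tendsto_snd_nearPairs.eventually ha.eventually_ne_zero] with x h1 h2
    simp only [Function.comp, Pi.div_apply]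
    by_cases h3 : b x.1 = 0
    · simp [h3]
    · field_simp

/-- This makes the balancing shifts negligible against the base points `2πin`. -/
theorem log_norm_isLittleO (ha : ModerateGrowth a) :
    (fun w => Real.log ‖a w‖) =o[cobounded ℂ] (fun w => ‖w‖) := by
  obtain ⟨δ, hδ, h⟩ := ha.lower
  obtain ⟨N, hN⟩ := ha.upper
  obtain ⟨c, hc, h1⟩ := hN.exists_pos
  have h2 : (fun w : ℂ => |Real.log δ| + |Real.log c| + N * Real.log ‖w‖)
      =o[cobounded ℂ] (fun w => ‖w‖) := by
    refine IsLittleO.add ?_ (IsLittleO.const_mul_left ?_ _)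
    · exact isLittleO_const_left.2
        (Or.inr (tendsto_norm_atTop_atTop.comp tendsto_norm_cobounded_atTop))
    · exact Real.isLittleO_log_id_atTop.comp_tendsto (tendsto_norm_cobounded_atTop (E := ℂ))
  refine IsBigO.trans_isLittleO (IsBigO.of_bound 1 ?_) h2
  filter_upwards [h, h1.bound, tendsto_norm_cobounded_atTop.eventually_ge_atTop 1]
    with w hw hw1 hw2
  have h0 := hδ.trans_le hw
  have h3 := Real.log_le_log hδ hw
  rw [norm_pow] at hw1
  have h4 := Real.log_le_log h0 hw1
  rw [Real.log_mul hc.ne' (by positivity), Real.log_pow] at h4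
  have h5 : 0 ≤ N * Real.log ‖w‖ := mul_nonneg (by positivity) (Real.log_nonneg hw2)
  rw [one_mul, Real.norm_eq_abs, Real.norm_eq_abs, abs_le]
  have := le_abs_self (|Real.log δ| + |Real.log c| + N * Real.log ‖w‖)
  constructor
  · linarith [neg_abs_le (Real.log δ), abs_nonneg (Real.log c)]
  · linarith [le_abs_self (Real.log c), abs_nonneg (Real.log δ)]

/-- Coefficients evaluated at `log w` are `o(w)`, so the top power of `w` dominates the sum. -/
theorem sum_comp_log_mul_pow {B : ℕ → ℂ → ℂ} {d : ℕ}
    (hB : ∀ i < d, ModerateGrowth (B i) ∨ B i = 0) (hd : ModerateGrowth (B d)) :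
    ModerateGrowth (fun w => ∑ i ∈ Finset.range (d + 1), B i (Complex.log w) * w ^ i) := by
  have hmain := hd.comp_log.mul_pow d
  refine hmain.congr_equivalent ?_
  have hO : (fun w : ℂ => w ^ d) =O[cobounded ℂ] (fun w => B d (Complex.log w) * w ^ d) := by
    simpa using hd.comp_log.one_isBigO.mul (isBigO_refl (fun w : ℂ => w ^ d) _)
  have ho : (fun w => ∑ i ∈ Finset.range d, B i (Complex.log w) * w ^ i)
      =o[cobounded ℂ] (fun w => w ^ d) := by
    refine IsLittleO.fun_sum fun i hi => ?_
    rw [Finset.mem_range] at hi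
    obtain h | h := hB i hi
    · refine (h.comp_log_isLittleO.mul_isBigO (isBigO_refl (fun w : ℂ => w ^ i) _)).trans_isBigO ?_
      refine IsBigO.of_bound 1 ?_
      filter_upwards [tendsto_norm_cobounded_atTop.eventually_ge_atTop 1] with w hw
      rw [← pow_succ', norm_pow, norm_pow, one_mul]
      exact pow_le_pow_right₀ hw hi
    · simp only [h, Pi.zero_apply, zero_mul]
      exact isLittleO_zero _ _
  refine (ho.trans_isBigO hO).congr_left fun w => ?_
  simp [Finset.sum_range_succ]

end ModerateGrowth

/-! ### Polynomials in iterated logarithms -/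

theorem MvPolynomial.eval_iterate_succ {R : Type*} [CommSemiring R] {n : ℕ} (g : R → R) (w : R)
    (q : MvPolynomial (Fin (n + 1)) R) :
    MvPolynomial.eval (fun i : Fin (n + 1) => g^[i] w) q =
      ((MvPolynomial.finSuccEquiv R n q).map
        (MvPolynomial.eval fun i : Fin n => g^[i] (g w))).eval w := by
  rw [← MvPolynomial.eval_eq_eval_mv_eval']
  congr 2
  funext i
  refine Fin.cases ?_ (fun j => ?_) i <;> simp

theorem MvPolynomial.moderateGrowth_eval_log {n : ℕ} (q : MvPolynomial (Fin n) ℂ) (hq : q ≠ 0) :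
    ModerateGrowth (fun w => MvPolynomial.eval (fun i : Fin n => Complex.log^[i] w) q) := by
  induction n with
  | zero =>
    obtain ⟨c, rfl⟩ : ∃ c, q = MvPolynomial.C c := ⟨_, MvPolynomial.eq_C_of_isEmpty q⟩
    simp only [MvPolynomial.eval_C]
    exact ModerateGrowth.const fun h => hq (by simp [h])
  | succ n ih =>
    set P := MvPolynomial.finSuccEquiv ℂ n q with hP
    have hP0 : P ≠ 0 := by simpa [hP] using hq
    have key := ModerateGrowth.sum_comp_log_mul_pow (d := P.natDegree)
      (B := fun i w => MvPolynomial.eval (fun i : Fin n => Complex.log^[i] w) (P.coeff i))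
      (fun i _ => ?_) (ih _ ?_)
    · convert key using 2 with w
      rw [MvPolynomial.eval_iterate_succ,
        Polynomial.eval_eq_sum_range' (Nat.lt_succ_of_le Polynomial.natDegree_map_le)]
      simp [hP]
    · by_cases h : P.coeff i = 0
      · right
        funext w
        simp [h]
      · exact Or.inl (ih _ h)
    · exact Polynomial.leadingCoeff_ne_zero.2 hP0

/-! ### Locating zeros, and the Newton polygon -/

/-- Otherwise `1/G` would violate the maximum modulus principle. -/
theorem Complex.exists_zero_of_norm_lt {G : ℂ → ℂ} {c : ℂ} {r m : ℝ} (hr : 0 < r)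
    (hd : DifferentiableOn ℂ G (Metric.closedBall c r))
    (hs : ∀ u ∈ Metric.sphere c r, m ≤ ‖G u‖) (hc : ‖G c‖ < m) :
    ∃ u ∈ Metric.closedBall c r, G u = 0 := by
  by_contra! h
  have hcl : closure (Metric.ball c r) = Metric.closedBall c r := closure_ball c hr.ne'
  have hdc : DiffContOnCl ℂ G⁻¹ (Metric.ball c r) :=
    (DifferentiableOn.diffContOnCl (hcl ▸ hd)).inv (by rwa [hcl])
  have hm : 0 < m := (norm_nonneg _).trans_lt hc
  have h1 := Complex.norm_le_of_forall_mem_frontier_norm_le (C := m⁻¹) Metric.isBounded_ball hdc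
    (fun u hu => by
      rw [frontier_ball c hr.ne'] at hu
      rw [Pi.inv_apply, norm_inv]
      exact inv_anti₀ hm (hs u hu)) (subset_closure (Metric.mem_ball_self hr))
  rw [Pi.inv_apply, norm_inv, inv_le_inv₀
    (norm_pos_iff.2 (h c (Metric.mem_closedBall_self hr.le))) hm] at h1
  exact h1.not_gt hc

theorem Polynomial.exists_ne_zero_isRoot {K : Type*} [Field K] [IsAlgClosed K]
    {Q : Polynomial K} {i j : ℕ} (hij : i ≠ j) (hi : Q.coeff i ≠ 0) (hj : Q.coeff j ≠ 0) :
    ∃ v, v ≠ 0 ∧ Q.IsRoot v := by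
  have hQ : Q ≠ 0 := by
    rintro rfl
    simp at hi
  obtain ⟨q, hq, hdvd⟩ := Polynomial.exists_eq_pow_rootMultiplicity_mul_and_not_dvd Q hQ 0
  rw [Polynomial.C_0, sub_zero] at hq hdvd
  by_cases hdeg : q.degree = 0
  · exfalso
    rw [Polynomial.eq_C_of_degree_eq_zero hdeg, mul_comm] at hq
    rw [hq, Polynomial.coeff_C_mul_X_pow] at hi hj
    simp only [ne_eq, ite_eq_right_iff, Classical.not_imp] at hi hj
    omega
  · obtain ⟨v, hv⟩ := IsAlgClosed.exists_root q hdeg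
    refine ⟨v, ?_, ?_⟩
    · rintro rfl
      rw [Polynomial.IsRoot.def, ← Polynomial.coeff_zero_eq_eval_zero] at hv
      exact hdvd (Polynomial.X_dvd_iff.2 hv)
    · rw [hq, Polynomial.IsRoot.def, Polynomial.eval_mul, hv, mul_zero]

/-- A non-monomial has a nonzero root, which `exp` attains; the identity theorem isolates the zero.
-/
theorem Polynomial.exists_isolated_zero_comp_exp {Q : Polynomial ℂ} {i j : ℕ} (hij : i ≠ j)
    (hi : Q.coeff i ≠ 0) (hj : Q.coeff j ≠ 0) :
    ∃ c : ℂ, ∃ r > 0, Q.eval (Complex.exp c) = 0 ∧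
      ∀ u ∈ Metric.sphere c r, Q.eval (Complex.exp u) ≠ 0 := by
  obtain ⟨v, hv, hroot⟩ := Polynomial.exists_ne_zero_isRoot hij hi hj
  have hdiff : Differentiable ℂ fun u => Q.eval (Complex.exp u) :=
    Q.differentiable.comp Complex.differentiable_exp
  obtain h | h := (hdiff.analyticAt (Complex.log v)).eventually_eq_zero_or_eventually_ne_zero
  · exfalso
    have h1 := AnalyticOnNhd.eqOn_zero_of_preconnected_of_eventuallyEq_zero
      (U := Set.univ) (fun u _ => hdiff.analyticAt u) isPreconnected_univ (Set.mem_univ _) h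
    have hQ : Q = 0 := by
      refine Polynomial.eq_zero_of_infinite_isRoot Q
        ((Set.finite_singleton (0 : ℂ)).infinite_compl.mono fun x hx => ?_)
      have := h1 (Set.mem_univ (Complex.log x))
      simpa [Complex.exp_log hx] using this
    simp [hQ] at hi
  · obtain ⟨ε, hε, hball⟩ := Metric.mem_nhdsWithin_iff.1 h
    refine ⟨Complex.log v, ε / 2, half_pos hε, by rwa [Complex.exp_log hv], fun u hu => ?_⟩
    rw [Metric.mem_sphere] at hu
    refine hball ⟨?_, ?_⟩
    · rw [Metric.mem_ball, hu]
      exact half_lt_self hε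
    · rintro rfl
      rw [dist_self] at hu
      exact (half_pos hε).ne hu

/-- A slope of the Newton polygon at its leftmost vertex. -/
theorem exists_balancing_slope {S : Finset ℕ} (l : ℕ → ℝ) {j₀ : ℕ} (h₀ : j₀ ∈ S)
    (hmin : ∀ j ∈ S, j₀ ≤ j) (hne : (S.erase j₀).Nonempty) :
    ∃ σ : ℝ, (∀ j ∈ S, l j + j * σ ≤ l j₀ + j₀ * σ) ∧
      (∃ j ∈ S.erase j₀, l j + j * σ = l j₀ + j₀ * σ) ∧ |σ| ≤ 2 * ∑ j ∈ S, |l j| := by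
  -- As `σ` grows, term `j > j₀` overtakes term `j₀` at this quotient; the smallest crossing keeps
  -- every other term below.
  obtain ⟨i, hi, heq⟩ := Finset.exists_mem_eq_inf' hne fun j => (l j₀ - l j) / ((j : ℝ) - j₀)
  set σ := (S.erase j₀).inf' hne fun j => (l j₀ - l j) / ((j : ℝ) - j₀) with hσ
  have hpos : ∀ j ∈ S.erase j₀, (1 : ℝ) ≤ (j : ℝ) - j₀ := by
    intro j hj
    rw [Finset.mem_erase] at hj
    have h1 : j₀ + 1 ≤ j := lt_of_le_of_ne (hmin j hj.2) (Ne.symm hj.1)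
    have : ((j₀ + 1 : ℕ) : ℝ) ≤ j := Nat.cast_le.2 h1
    push_cast at this
    linarith
  have hi1 := hpos i hi
  refine ⟨σ, fun j hj => ?_, ⟨i, hi, ?_⟩, ?_⟩
  · by_cases hjj : j = j₀
    · rw [hjj]
    · have hj' := Finset.mem_erase.2 ⟨hjj, hj⟩
      have h1 := Finset.inf'_le (fun j : ℕ => (l j₀ - l j) / ((j : ℝ) - j₀)) hj'
      rw [← hσ, le_div_iff₀ (by linarith [hpos j hj'])] at h1
      linarith
  · rw [eq_div_iff (by linarith)] at heq
    linarith
  · have h1 := Finset.single_le_sum (f := fun j => |l j|) (fun j _ => abs_nonneg _) h₀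
    have h2 := Finset.single_le_sum (f := fun j => |l j|) (fun j _ => abs_nonneg _)
      (Finset.mem_of_mem_erase hi)
    rw [heq, abs_div, abs_of_pos (by linarith : 0 < (i : ℝ) - j₀)]
    calc |l j₀ - l i| / ((i : ℝ) - j₀) ≤ |l j₀ - l i| := div_le_self (abs_nonneg _) hi1
      _ ≤ |l j₀| + |l i| := abs_sub _ _
      _ ≤ _ := by linarith

/-! ### Zeros of exponential sums -/

theorem exists_zero_exp_sum {S : Finset ℕ} (hS : S.Nontrivial) {a : ℕ → ℂ → ℂ}
    (ha : ∀ j ∈ S, ModerateGrowth (a j))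
    (hd : ∀ j ∈ S, ∀ᶠ w in cobounded ℂ, w ∈ Complex.slitPlane → DifferentiableAt ℂ (a j) w)
    (M : ℝ) : ∃ w, M < ‖w‖ ∧ ∑ j ∈ S, a j w * Complex.exp w ^ j = 0 := by
  obtain ⟨j₀, h₀, hmin⟩ : ∃ j₀ ∈ S, ∀ j ∈ S, j₀ ≤ j :=
    ⟨S.min' hS.nonempty, S.min'_mem _, fun j hj => S.min'_le j hj⟩
  have hne : (S.erase j₀).Nonempty := hS.erase_nonempty
  -- Periods of `exp`: translating by `c n` leaves the exponentials unchanged.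
  set c : ℕ → ℂ := fun n => n * (2 * Real.pi * Complex.I) with hc
  have hcnorm : ∀ n, ‖c n‖ = n * (2 * Real.pi) := fun n => by
    simp [hc, abs_of_pos Real.pi_pos]
  have hcexp : ∀ n, Complex.exp (c n) = 1 := fun n => Complex.exp_int_mul_two_pi_mul_I n
  have hctop : Tendsto c atTop (cobounded ℂ) := by
    rw [← tendsto_norm_atTop_iff_cobounded]
    simp only [hcnorm]
    exact tendsto_natCast_atTop_atTop.atTop_mul_const (by positivity)
  choose σ hσ1 hσ2 hσ3 using fun n =>
    exists_balancing_slope (fun j => Real.log ‖a j (c n)‖) h₀ hmin hne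
  have hσo : Tendsto (fun n => (σ n : ℂ) / c n) atTop (𝓝 0) := by
    have h1 : (fun n => 2 * ∑ j ∈ S, |Real.log ‖a j (c n)‖|) =o[atTop] (fun n => ‖c n‖) := by
      refine IsLittleO.const_mul_left (IsLittleO.fun_sum fun j hj => ?_) _
      exact ((ha j hj).log_norm_isLittleO.comp_tendsto hctop).abs_left
    have h2 : (fun n => (σ n : ℂ)) =o[atTop] (fun n => ‖c n‖) := by
      refine IsBigO.trans_isLittleO (IsBigO.of_bound 1 (Eventually.of_forall fun n => ?_)) h1
      rw [Complex.norm_real, one_mul, Real.norm_eq_abs]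
      exact (hσ3 n).trans (le_abs_self _)
    exact h2.of_norm_right.tendsto_div_nhds_zero
  set A : ℕ → ℂ := fun n => a j₀ (c n) * Complex.exp (σ n) ^ j₀ with hA
  set B : ℕ → ℕ → ℂ := fun j n => a j (c n) * Complex.exp (σ n) ^ j / A n with hB
  have hane : ∀ᶠ n in atTop, ∀ j ∈ S, a j (c n) ≠ 0 :=
    (Finset.eventually_all S).2 fun j hj => hctop.eventually (ha j hj).eventually_ne_zero
  have hnorm : ∀ j n, a j (c n) ≠ 0 → ‖a j (c n) * Complex.exp (σ n) ^ j‖ =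
      Real.exp (Real.log ‖a j (c n)‖ + j * σ n) := fun j n h => by
    rw [Real.exp_add, Real.exp_log (norm_pos_iff.2 h), norm_mul, norm_pow, Complex.norm_exp,
      Complex.ofReal_re, Real.exp_nat_mul]
  have hAne : ∀ᶠ n in atTop, A n ≠ 0 := hane.mono fun n hn =>
    mul_ne_zero (hn j₀ h₀) (pow_ne_zero _ (Complex.exp_ne_zero _))
  have hBle : ∀ᶠ n in atTop, ∀ j ∈ S, ‖B j n‖ ≤ 1 := hane.mono fun n hn j hj => by
    rw [hB, norm_div, hnorm j n (hn j hj), hnorm j₀ n (hn j₀ h₀), div_le_one (Real.exp_pos _)]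
    exact Real.exp_le_exp.2 (hσ1 n j hj)
  have hBsum : ∀ᶠ n in atTop, 1 ≤ ∑ j ∈ S.erase j₀, ‖B j n‖ := hane.mono fun n hn => by
    obtain ⟨j, hj, heq⟩ := hσ2 n
    have h1 : ‖B j n‖ = 1 := by
      rw [hB, norm_div, hnorm j n (hn j (Finset.mem_of_mem_erase hj)), hnorm j₀ n (hn j₀ h₀), heq,
        div_self (Real.exp_ne_zero _)]
    rw [← h1]
    exact Finset.single_le_sum (f := fun j => ‖B j n‖) (fun j _ => norm_nonneg _) hj
  -- An ultrafilter replaces the passage to convergent subsequences.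
  set L : Filter ℕ := (hyperfilter ℕ : Filter ℕ) with hL
  have hLtop : L ≤ atTop := Nat.hyperfilter_le_atTop
  have hlim : ∀ j, ∃ β : ℂ, j ∈ S → Tendsto (B j) L (𝓝 β) := fun j => by
    by_cases hj : j ∈ S
    · obtain ⟨β, -, hβ⟩ := (isCompact_closedBall (0 : ℂ) 1).ultrafilter_le_nhds'
        ((hyperfilter ℕ).map (B j)) (by
          rw [Ultrafilter.mem_map]
          filter_upwards [hLtop hBle] with n hn
          simpa using hn j hj)
      exact ⟨β, fun _ => hβ⟩
    · exact ⟨0, fun h => absurd h hj⟩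
  choose β hβ using hlim
  have hβ0 : β j₀ = 1 := by
    refine tendsto_nhds_unique (hβ j₀ h₀) (tendsto_const_nhds.congr' ?_)
    filter_upwards [hLtop hAne] with n hn
    exact (div_self hn).symm
  -- For large `n` some balanced term has norm one, so the limits cannot all vanish; hence `Q` is
  -- not a monomial.
  obtain ⟨j₁, hj₁, hβ1⟩ : ∃ j ∈ S.erase j₀, β j ≠ 0 := by
    have h1 := tendsto_finsetSum (S.erase j₀)
      fun j hj => (hβ j (Finset.mem_of_mem_erase hj)).norm
    have h2 := ge_of_tendsto h1 (hLtop hBsum)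
    by_contra! h
    rw [Finset.sum_eq_zero fun j hj => by rw [h j hj, norm_zero]] at h2
    linarith
  set Q : Polynomial ℂ := ∑ j ∈ S, Polynomial.C (β j) * Polynomial.X ^ j with hQ
  have hQcoeff : ∀ j ∈ S, Q.coeff j = β j := fun j hj => by
    simp [hQ, Polynomial.coeff_X_pow, hj]
  have hQeval : ∀ x, Q.eval x = ∑ j ∈ S, β j * x ^ j := fun x => by
    simp [hQ, Polynomial.eval_finsetSum]
  obtain ⟨u₀, r, hr, hu₀, hsph⟩ := Polynomial.exists_isolated_zero_comp_exp
    (Finset.ne_of_mem_erase hj₁).symm (by rw [hQcoeff _ h₀, hβ0]; exact one_ne_zero)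
    (by rwa [hQcoeff _ (Finset.mem_of_mem_erase hj₁)])
  set K := Metric.closedBall u₀ r with hK
  set W : ℕ × ℂ → ℂ := fun x => c x.1 + (σ x.1 + x.2) with hW
  have hfst : Tendsto Prod.fst (L ×ˢ 𝓟 K) atTop := tendsto_fst.mono_right hLtop
  have hbdd : ∀ f : ℂ → ℂ, Continuous f →
      IsBoundedUnder (· ≤ ·) (L ×ˢ 𝓟 K) (norm ∘ fun x : ℕ × ℂ => f x.2) := fun f hf => by
    obtain ⟨C, hC⟩ := (isCompact_closedBall u₀ r).exists_bound_of_continuousOn hf.continuousOn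
    refine ⟨C, ?_⟩
    rw [eventually_map, eventually_prod_principal_iff]
    exact Eventually.of_forall fun n u hu => hC u hu
  have hcfst := hctop.comp hfst
  have hnear : Tendsto (fun x => (c x.1, W x)) (L ×ˢ 𝓟 K) nearPairs := by
    refine tendsto_nearPairs hcfst ?_
    have h1 := (tendsto_inv₀_cobounded.comp hcfst).zero_mul_isBoundedUnder_le
      (hbdd (fun u => u) continuous_id)
    have h2 := ((hσo.comp hfst).add h1).const_add 1
    rw [add_zero, add_zero] at h2
    refine h2.congr' ?_
    filter_upwards [hcfst.eventually_ne_cobounded 0] with x hx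
    simp only [Function.comp, hW] at hx ⊢
    field_simp
  have hWtop : Tendsto W (L ×ˢ 𝓟 K) (cobounded ℂ) := tendsto_snd_nearPairs.comp hnear
  set G : ℕ × ℂ → ℂ := fun x => ∑ j ∈ S, a j (W x) * Complex.exp (W x) ^ j / A x.1 with hG
  -- The factor `𝓟 K` makes the convergence uniform for `u` in the disc.
  have hconv : Tendsto (fun x => G x - Q.eval (Complex.exp x.2)) (L ×ˢ 𝓟 K) (𝓝 0) := by
    have hterm : ∀ j ∈ S, Tendsto (fun x : ℕ × ℂ =>
        (a j (W x) / a j (c x.1) * B j x.1 - β j) * Complex.exp x.2 ^ j)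
        (L ×ˢ 𝓟 K) (𝓝 0) := fun j hj => by
      have h1 := (((ha j hj).slow.comp hnear).mul ((hβ j hj).comp tendsto_fst)).sub_const (β j)
      rw [one_mul, sub_self] at h1
      exact h1.zero_mul_isBoundedUnder_le
        (hbdd (fun u => Complex.exp u ^ j) (Complex.continuous_exp.pow j))
    have h2 := tendsto_finsetSum S hterm
    rw [Finset.sum_const_zero] at h2
    refine h2.congr' ?_
    filter_upwards [hfst.eventually hane] with x hx
    rw [hQeval, hG, ← Finset.sum_sub_distrib]
    refine Finset.sum_congr rfl fun j hj => ?_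
    have h3 := hx j hj
    simp only [hB, hW, Complex.exp_add, hcexp, one_mul, mul_pow]
    field_simp
  obtain ⟨m, hm, hmle⟩ : ∃ m > 0, ∀ u ∈ Metric.sphere u₀ r, m ≤ ‖Q.eval (Complex.exp u)‖ := by
    obtain ⟨u, hu, hmin⟩ := (isCompact_sphere u₀ r).exists_isMinOn
      (NormedSpace.sphere_nonempty.2 hr.le)
      (f := fun u => ‖Q.eval (Complex.exp u)‖)
      (Q.continuous.comp Complex.continuous_exp).norm.continuousOn
    exact ⟨_, norm_pos_iff.2 (hsph u hu), fun v hv => hmin hv⟩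
  -- An error below `m / 2` leaves `‖G‖ ≥ m / 2` on the circle and `‖G‖ < m / 2` at the centre,
  -- where the limit vanishes.
  have hclose := hconv.norm.eventually_lt_const (u := m / 2) (by simpa using half_pos hm)
  have hdiff : ∀ᶠ x in L ×ˢ 𝓟 K, ∀ j ∈ S,
      W x ∈ Complex.slitPlane → DifferentiableAt ℂ (a j) (W x) :=
    hWtop.eventually ((Finset.eventually_all S).2 hd)
  -- The imaginary part `2πn + Im u` is eventually positive, so the branch cut is avoided.
  have him : ∀ᶠ x in L ×ˢ 𝓟 K, W x ∈ Complex.slitPlane := by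
    have h1 : Tendsto (fun n : ℕ => n * (2 * Real.pi)) atTop atTop :=
      tendsto_natCast_atTop_atTop.atTop_mul_const (by positivity)
    rw [eventually_prod_principal_iff]
    filter_upwards [hLtop (h1.eventually_gt_atTop (‖u₀‖ + r))] with n hn u hu
    refine Complex.mem_slitPlane_iff.2 (Or.inr (ne_of_gt ?_))
    have h2 : ‖u‖ ≤ ‖u₀‖ + r := norm_le_of_mem_closedBall hu
    have h3 := (abs_le.1 (Complex.abs_im_le_norm u)).1
    have h4 : (W (n, u)).im = n * (2 * Real.pi) + u.im := by simp [hW, hc]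
    rw [h4]
    linarith
  have hall := hclose.and (hdiff.and (him.and
    ((tendsto_norm_atTop_iff_cobounded.2 hWtop).eventually_gt_atTop M)))
  rw [eventually_prod_principal_iff] at hall
  obtain ⟨n, hn, hAn⟩ := (hall.and (hLtop hAne)).exists
  obtain ⟨u, hu, hzero⟩ := Complex.exists_zero_of_norm_lt (G := fun u => G (n, u)) (m := m / 2) hr
    (fun u hu => DifferentiableAt.differentiableWithinAt (by
      have hWd : DifferentiableAt ℂ (fun u => W (n, u)) u := by
        simp only [hW]
        fun_prop
      refine DifferentiableAt.fun_sum fun j hj => ?_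
      have haj : DifferentiableAt ℂ (fun u => a j (W (n, u))) u :=
        ((hn u hu).2.1 j hj (hn u hu).2.2.1).comp u hWd
      exact (haj.mul (hWd.cexp.pow j)).div_const (A n)))
    (fun u hu => by
      have h1 := (hn u (Metric.sphere_subset_closedBall hu)).1
      have h2 := hmle u hu
      have h3 := norm_sub_rev (G (n, u)) (Q.eval (Complex.exp u))
      have h4 := norm_sub_norm_le (Q.eval (Complex.exp u)) (G (n, u))
      simp only at h1
      linarith)
    (by
      have h1 := (hn u₀ (Metric.mem_closedBall_self hr.le)).1
      simpa only [hu₀, sub_zero] using h1)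
  refine ⟨W (n, u), (hn u hu).2.2.2, ?_⟩
  simp only [hG] at hzero
  rwa [← Finset.sum_div, div_eq_zero_iff, or_iff_left hAn] at hzero

/-! ### Returning from `w` to `z` -/

theorem Complex.tendsto_iterate_log_cobounded (m : ℕ) :
    Tendsto (Complex.log^[m]) (cobounded ℂ) (cobounded ℂ) :=
  Complex.tendsto_log_cobounded.iterate m

theorem Complex.eventually_differentiableAt_iterate_log (m : ℕ) :
    ∀ᶠ w in cobounded ℂ, w ∈ Complex.slitPlane → DifferentiableAt ℂ (Complex.log^[m]) w := by
  induction m with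
  | zero => exact Eventually.of_forall fun w _ => differentiableAt_id
  | succ m ih =>
    filter_upwards [Complex.tendsto_log_cobounded.eventually ih,
      tendsto_norm_cobounded_atTop.eventually_gt_atTop 1] with w hw h1 hs
    rw [Function.iterate_succ]
    refine (hw (Complex.mem_slitPlane_iff.2 (Or.inl ?_))).comp w (differentiableAt_log hs)
    rw [Complex.log_re]
    exact Real.log_pos h1

theorem Complex.eventually_iterate_exp_iterate_log (m : ℕ) :
    ∀ᶠ w in cobounded ℂ, Complex.exp^[m] (Complex.log^[m] w) = w := by
  induction m with
  | zero => exact Eventually.of_forall fun w => rfl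
  | succ m ih =>
    filter_upwards [Complex.tendsto_log_cobounded.eventually ih,
      eventually_ne_cobounded (0 : ℂ)] with w hw h0
    rw [Function.iterate_succ_apply Complex.log, Function.iterate_succ_apply' Complex.exp, hw,
      Complex.exp_log h0]

theorem Complex.eventually_iterate_exp_sub_iterate_log (k : ℕ) :
    ∀ᶠ w in cobounded ℂ, ∀ i : Fin (k + 1),
      Complex.exp^[k - i] (Complex.log^[k] w) = Complex.log^[i] w := by
  rw [eventually_all]
  intro i
  filter_upwards [(Complex.tendsto_iterate_log_cobounded i).eventually
    (Complex.eventually_iterate_exp_iterate_log (k - i))] with w hw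
  rw [← Function.iterate_add_apply, Nat.sub_add_cancel (Nat.lt_succ_iff.1 i.2)] at hw
  exact hw

theorem MvPolynomial.differentiableAt_eval {ι : Type*} (q : MvPolynomial ι ℂ) {f : ι → ℂ → ℂ}
    {w : ℂ} (hf : ∀ i, DifferentiableAt ℂ (f i) w) :
    DifferentiableAt ℂ (fun w => MvPolynomial.eval (fun i => f i w) q) w := by
  induction q using MvPolynomial.induction_on with
  | C c => simp
  | add p q hp hq =>
    simp only [map_add]
    exact hp.add hq
  | mul_X p i hp =>
    simp only [map_mul, MvPolynomial.eval_X]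
    exact hp.mul (hf i)

theorem MvPolynomial.eval_iterate_exp_succ (k : ℕ) (q : MvPolynomial (Fin (k + 2)) ℂ) (z : ℂ) :
    MvPolynomial.eval (fun i : Fin (k + 2) => Complex.exp^[k + 1 - i] z) q =
      ∑ j ∈ (MvPolynomial.finSuccEquiv ℂ (k + 1) q).support,
        MvPolynomial.eval (fun i : Fin (k + 1) => Complex.exp^[k - i] z)
          ((MvPolynomial.finSuccEquiv ℂ (k + 1) q).coeff j) *
        Complex.exp (Complex.exp^[k] z) ^ j := by
  have h : (fun i : Fin (k + 2) => Complex.exp^[k + 1 - i] z) =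
      Fin.cons (Complex.exp (Complex.exp^[k] z)) fun i : Fin (k + 1) => Complex.exp^[k - i] z := by
    funext i
    refine Fin.cases ?_ (fun j => ?_) i
    · simp [← Function.iterate_succ_apply']
    · simp
  rw [h, MvPolynomial.eval_eq_eval_mv_eval', Polynomial.eval_map, Polynomial.eval₂_eq_sum,
    Polynomial.sum]

theorem infinite_zeros_of_nontrivial_support {k : ℕ} (q : MvPolynomial (Fin (k + 2)) ℂ)
    (hq : (MvPolynomial.finSuccEquiv ℂ (k + 1) q).support.Nontrivial) :
    {z : ℂ | MvPolynomial.eval (fun i : Fin (k + 2) => Complex.exp^[k + 1 - i] z) q = 0}.Infinite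
    := by
  set P := MvPolynomial.finSuccEquiv ℂ (k + 1) q with hP
  set a : ℕ → ℂ → ℂ := fun j w =>
    MvPolynomial.eval (fun i : Fin (k + 1) => Complex.log^[i] w) (P.coeff j) with ha
  have hzero := exists_zero_exp_sum (a := a) hq
    (fun j hj => MvPolynomial.moderateGrowth_eval_log _ (Polynomial.mem_support_iff.1 hj))
    (fun j _ => by
      have h1 : ∀ᶠ w in cobounded ℂ, ∀ i : Fin (k + 1),
          w ∈ Complex.slitPlane → DifferentiableAt ℂ (Complex.log^[i]) w :=
        eventually_all.2 fun i => Complex.eventually_differentiableAt_iterate_log i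
      filter_upwards [h1] with w hw hs
      exact MvPolynomial.differentiableAt_eval _ fun i => hw i hs)
  intro hfin
  -- Finitely many zeros `z` would have bounded images `w = exp^[k] z`.
  obtain ⟨M, hM⟩ := (hfin.image (Complex.exp^[k])).isBounded.exists_norm_le
  obtain ⟨R, -, hR⟩ := (hasBasis_cobounded_norm (E := ℂ)).eventually_iff.1
    (Complex.eventually_iterate_exp_sub_iterate_log k)
  obtain ⟨w, hw, h0⟩ := hzero (max M R)
  have hw1 := hR (le_of_lt ((le_max_right M R).trans_lt hw))
  have hw2 : Complex.exp^[k] (Complex.log^[k] w) = w := by simpa using hw1 0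
  refine (hM w ⟨Complex.log^[k] w, ?_, hw2⟩).not_gt ((le_max_left M R).trans_lt hw)
  rw [Set.mem_ofPred_eq, MvPolynomial.eval_iterate_exp_succ]
  simp only [hw1, hw2]
  exact h0

/-! ### Induction on the number of exponentials -/

theorem MvPolynomial.finSuccEquiv_rename_succ {R : Type*} [CommSemiring R] {n : ℕ}
    (b : MvPolynomial (Fin n) R) :
    MvPolynomial.finSuccEquiv R n (MvPolynomial.rename Fin.succ b) = Polynomial.C b := by
  induction b using MvPolynomial.induction_on with
  | C c => simp [MvPolynomial.finSuccEquiv_apply]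
  | add p q hp hq => rw [map_add, map_add, hp, hq, Polynomial.C_add]
  | mul_X p i hp =>
    rw [map_mul, map_mul, hp, MvPolynomial.rename_X, MvPolynomial.finSuccEquiv_X_succ,
      Polynomial.C_mul]

/-- The variables run from the outermost exponential inward, so that `finSuccEquiv` isolates the
outermost one; zeros of the cofactor remain zeros of the product. -/
theorem exists_eq_or_infinite_zeros (k : ℕ) (q : MvPolynomial (Fin (k + 1)) ℂ) :
    (∃ (g : Polynomial ℂ) (n : Fin k → ℕ),
      q = Polynomial.aeval (MvPolynomial.X (Fin.last k) : MvPolynomial (Fin (k + 1)) ℂ) g *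
        ∏ i : Fin k, MvPolynomial.X i.castSucc ^ n i) ∨
    {z : ℂ | MvPolynomial.eval (fun i : Fin (k + 1) => Complex.exp^[k - i] z) q = 0}.Infinite := by
  induction k with
  | zero =>
    left
    refine ⟨MvPolynomial.aeval (fun _ => Polynomial.X) q, Fin.elim0, ?_⟩
    rw [Finset.univ_eq_empty, Finset.prod_empty, mul_one]
    have h : ((Polynomial.aeval (MvPolynomial.X (Fin.last 0) : MvPolynomial (Fin 1) ℂ)).comp
        (MvPolynomial.aeval fun _ => Polynomial.X)) = AlgHom.id ℂ (MvPolynomial (Fin 1) ℂ) := by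
      refine MvPolynomial.algHom_ext fun i => ?_
      simp [Subsingleton.elim i (Fin.last 0)]
    exact (DFunLike.congr_fun h q).symm
  | succ k ih =>
    by_cases hS : (MvPolynomial.finSuccEquiv ℂ (k + 1) q).support.Nontrivial
    · exact Or.inr (infinite_zeros_of_nontrivial_support q hS)
    rw [← Finset.one_lt_card_iff_nontrivial, not_lt,
      Polynomial.card_support_le_one_iff_monomial] at hS
    obtain ⟨j, b, hb⟩ := hS
    have hqb : q = MvPolynomial.rename Fin.succ b * MvPolynomial.X 0 ^ j := by
      apply (MvPolynomial.finSuccEquiv ℂ (k + 1)).injective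
      rw [hb, map_mul, map_pow, MvPolynomial.finSuccEquiv_rename_succ,
        MvPolynomial.finSuccEquiv_X_zero, Polynomial.C_mul_X_pow_eq_monomial]
    obtain ⟨g, n, hg⟩ | hinf := ih b
    · left
      refine ⟨g, Fin.cons j n, ?_⟩
      rw [hqb, hg, map_mul, map_prod, ← Polynomial.aeval_algHom_apply, Fin.prod_univ_succ]
      simp only [map_pow, MvPolynomial.rename_X, Fin.succ_last, Fin.cons_zero, Fin.cons_succ,
        Fin.castSucc_zero, Fin.succ_castSucc]
      ring
    · right
      refine hinf.mono fun z hz => ?_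
      rw [Set.mem_ofPred_eq] at hz ⊢
      rw [hqb, map_mul, MvPolynomial.eval_rename]
      refine mul_eq_zero_of_left ?_ _
      convert hz using 3
      funext i
      simp

theorem mainTheorem11 (k : ℕ) (p : MvPolynomial (Fin (k + 1)) ℂ) (hp : Irreducible p)
    (hform : ¬ ∃ (g : Polynomial ℂ) (n : Fin k → ℕ),
      p = Polynomial.aeval (MvPolynomial.X 0 : MvPolynomial (Fin (k + 1)) ℂ) g *
        ∏ i : Fin k, MvPolynomial.X i.succ ^ n i) :
    {z : ℂ | MvPolynomial.eval (fun i : Fin (k + 1) => Complex.exp^[(i : ℕ)] z) p = 0}.Infinite := by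
  obtain ⟨g, n, hg⟩ | hinf := exists_eq_or_infinite_zeros k (MvPolynomial.rename Fin.rev p)
  · refine absurd ⟨g, n ∘ Fin.rev, ?_⟩ hform
    have h := congrArg (MvPolynomial.rename Fin.rev) hg
    rw [MvPolynomial.rename_rename, Fin.rev_involutive.comp_self, MvPolynomial.rename_id_apply,
      map_mul, map_prod, ← Polynomial.aeval_algHom_apply] at h
    simp only [map_pow, MvPolynomial.rename_X, Fin.rev_last, Fin.rev_castSucc] at h
    rw [h, ← Equiv.prod_comp Fin.revPerm]
    simp
  · convert hinf using 3 with z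
    rw [MvPolynomial.eval_rename]
    congr! 3
    funext i
    rw [Function.comp_apply, Fin.val_rev]
    congr 1
    omega
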